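/- Let $d\ge 2$, $N\ge 1$ and $L\ge 2$ be integers with $L$ even, and let $\beta\ge 0$. Consider the torus $\mathbb T_L=\mathbb Z^d/L\mathbb Z^d$ as a finite simple graph with nearest-neighbour edges $\mathcal E_L$ and origin $o$. For a spin configuration $\varphi=(\varphi_x)_{x\in\mathbb T_L}\in(\mathbb S^{N-1})^{\mathbb T_L}$, where $\mathbb S^{N-1}\subset\mathbb R^N$ is the unit sphere and $\varphi_x=(\varphi_x^1,\dots,\varphi_x^N)$, let $H(\varphi)=-\sum_{\{x,y\}\in\mathcal E_L}\varphi_x\cdot\varphi_y$ and $$\langle f\rangle=\frac{\int f(\varphi)\,e^{-\beta H(\varphi)}\prod_{x\in\mathbb T_L} d\varphi_x}{\int e^{-\beta H(\varphi)}\prod_{x\in\mathbb T_L} d\varphi_x},$$ where $d\varphi_x$ is the uniform probability measure on $\mathbb S^{N-1}$. Let $\mathcal H_L\subset\mathbb T_L$ be the set of vertices that either have all coordinates nonzero or have exactly one nonzero coordinate, and let $\mathbb B_{L/8}$ be the set of $z\in\mathbb T_L$ with $\|z\|_\infty\le L/8$ in the torus metric. Suppose that for some $\delta\in(0,1)$ $$\frac1{|\mathbb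 T_L|}\sum_{z\in\mathbb T_L}\langle\varphi^1_o\varphi^1_z\rangle\ \ge\ \frac1N-\delta .$$ Then $$\langle\varphi^1_o\varphi^1_y\rangle\ \ge\ \frac1N-2^{2d}\delta\qquad\text{for all } y\in\mathbb B_{L/8}\cap\mathcal H_L,$$ $$\langle\varphi^1_o\varphi^1_y\rangle\ \ge\ \Big(\frac1N-2^{2d}\delta\Big)\Big(\frac{\beta e^{-2d\beta}}{N}\Big)^{d-2}\qquad\text{for all } y\in\mathbb B_{L/8}\setminus\mathcal H_L,$$ with the convention $0^0=1$ when $d=2$ and $\beta=0$. -/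

import Mathlib

open MeasureTheory
open scoped BigOperators

noncomputable section

/-! ### The spin `O(N)` model on a finite graph -/

/-- The unit sphere `𝕊^{N-1}` of `ℝ^N`. -/
abbrev SpinSphere (N : ℕ) : Type :=
  Metric.sphere (0 : EuclideanSpace ℝ (Fin N)) 1

/-- The uniform probability measure on `𝕊^{N-1}`: the surface measure induced by Lebesgue measure
on `ℝ^N`, divided by its total mass (for `N = 1` each of the two points gets mass `1/2`). -/
def uniformSphere (N : ℕ) : Measure (SpinSphere N) :=
  ((volume : Measure (EuclideanSpace ℝ (Fin N))).toSphere Set.univ)⁻¹ •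
    (volume : Measure (EuclideanSpace ℝ (Fin N))).toSphere

/-- The inner product `φ_x · φ_y` along an undirected edge `{x, y}`. -/
def edgeInner {V : Type*} {N : ℕ} (φ : V → SpinSphere N) : Sym2 V → ℝ :=
  Sym2.lift
    ⟨fun x y => inner ℝ (φ x : EuclideanSpace ℝ (Fin N)) (φ y : EuclideanSpace ℝ (Fin N)),
      fun _ _ => real_inner_comm _ _⟩

open Classical in
/-- The hamiltonian `H(φ) = - ∑_{{x,y} ∈ E} φ_x · φ_y`. -/
def hamiltonian {V : Type*} [Fintype V] (G : SimpleGraph V) {N : ℕ} (φ : V → SpinSphere N) : ℝ :=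
  -∑ e ∈ G.edgeFinset, edgeInner φ e

/-- The partition function `Z = ∫ e^{-β H(φ)} dφ`, for the product of the uniform measures. -/
def spinPartition {V : Type*} [Fintype V] (G : SimpleGraph V) (N : ℕ) (β : ℝ) : ℝ :=
  ∫ φ, Real.exp (-β * hamiltonian G φ) ∂(Measure.pi fun _ : V => uniformSphere N)

/-- The expectation `⟨f⟩ = Z⁻¹ ∫ f(φ) e^{-β H(φ)} dφ`. -/
def spinExpectation {V : Type*} [Fintype V] (G : SimpleGraph V) (N : ℕ) (β : ℝ)
    (f : (V → SpinSphere N) → ℝ) : ℝ :=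
  (1 / spinPartition G N β) *
    ∫ φ, f φ * Real.exp (-β * hamiltonian G φ) ∂(Measure.pi fun _ : V => uniformSphere N)

/-! ### The torus -/

/-- The vertices of the torus `ℤ^d / L ℤ^d`. -/
abbrev Torus (d L : ℕ) : Type := Fin d → ZMod L

/-- The torus as a simple graph with nearest-neighbour edges. -/
def torusGraph (d L : ℕ) : SimpleGraph (Torus d L) :=
  SimpleGraph.fromRel fun x y => ∃ i : Fin d, y = x + Pi.single i 1

/-- The two-point function `⟨φ¹_o φ¹_z⟩` of the spin `O(N)` model on the torus; the first component
of a spin has index `0 : Fin N`. -/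
def twoPoint (d L N : ℕ) [NeZero L] [NeZero N] (β : ℝ) (z : Torus d L) : ℝ :=
  spinExpectation (torusGraph d L) N β fun φ =>
    (φ 0 : EuclideanSpace ℝ (Fin N)) 0 * (φ z : EuclideanSpace ℝ (Fin N)) 0

/-- The box `{z : ‖z‖_∞ ≤ r}` for the torus metric: `(z i).valMinAbs` is the representative of
`z i` of least absolute value, so its absolute value is the distance from `z i` to `0`. -/
def torusBox (d L : ℕ) (r : ℝ) : Set (Torus d L) :=
  {z | ∀ i, |((z i).valMinAbs : ℝ)| ≤ r}

/-- The vertices all of whose coordinates are nonzero, together with those that have exactly one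
nonzero coordinate (the coordinate axes without the origin). -/
def axesOrGeneric (d L : ℕ) : Set (Torus d L) :=
  {x | (∀ i, x i ≠ 0) ∨ ∃ i, x i ≠ 0 ∧ ∀ j, j ≠ i → x j = 0}

end

noncomputable section

/-! By translation invariance and `⟨(φ¹_x)²⟩ = 1/N`, the defect `D(y) = 1/N - ⟨φ¹_o φ¹_y⟩` is half a
squared `L²` distance, so `D(y) ≤ 2 D(z) + 2 D(y - z)` for every `z`. Averaging over `z` gives `D(y)
≤ 4δ ≤ 2^(2d) δ` at every vertex `y` of the torus (`twoPoint_ge_of_average`). The factor in the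
second bound lies in `[0, 1]`, so that bound follows from the first when `1/N - 2^(2d) δ ≥ 0`.
Otherwise its right-hand side is nonpositive, and Griffiths' first inequality (`twoPoint_nonneg`)
suffices. -/

/-! ### Orthogonal invariance of the uniform measure -/

/-- The action of a linear isometry on the unit sphere. -/
def sphereIsometry {N : ℕ} (T : EuclideanSpace ℝ (Fin N) ≃ₗᵢ[ℝ] EuclideanSpace ℝ (Fin N))
    (s : SpinSphere N) : SpinSphere N :=
  ⟨T s, by simp [T.norm_map]⟩

@[simp]
theorem coe_sphereIsometry {N : ℕ}
    (T : EuclideanSpace ℝ (Fin N) ≃ₗᵢ[ℝ] EuclideanSpace ℝ (Fin N)) (s : SpinSphere N) :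
    (sphereIsometry T s : EuclideanSpace ℝ (Fin N)) = T s := rfl

theorem continuous_sphereIsometry {N : ℕ}
    (T : EuclideanSpace ℝ (Fin N) ≃ₗᵢ[ℝ] EuclideanSpace ℝ (Fin N)) :
    Continuous (sphereIsometry T) :=
  (T.continuous.comp continuous_subtype_val).subtype_mk _

instance isProbabilityMeasure_uniformSphere (N : ℕ) [NeZero N] :
    IsProbabilityMeasure (uniformSphere N) := by
  have : Nonempty (Fin N) := ⟨0⟩
  have h0 : (volume : Measure (EuclideanSpace ℝ (Fin N))).toSphere Set.univ ≠ 0 := by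
    rw [Ne, Measure.measure_univ_eq_zero]
    exact Measure.toSphere_ne_zero _
  refine ⟨?_⟩
  rw [uniformSphere, Measure.smul_apply, smul_eq_mul, ENNReal.inv_mul_cancel h0 (measure_ne_top _ _)]

-- Up to a constant, the surface measure of `s` is the volume of the cone `(0, 1) • s`; a linear
-- isometry maps cones to cones and preserves volume.
open scoped Pointwise in
theorem measurePreserving_sphereIsometry {N : ℕ}
    (T : EuclideanSpace ℝ (Fin N) ≃ₗᵢ[ℝ] EuclideanSpace ℝ (Fin N)) :
    MeasurePreserving (sphereIsometry T) (uniformSphere N) (uniformSphere N) := by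
  refine ⟨(continuous_sphereIsometry T).measurable, ?_⟩
  rw [uniformSphere, Measure.map_smul]
  congr 1
  ext s hs
  have hm := (continuous_sphereIsometry T).measurable hs
  rw [Measure.map_apply (continuous_sphereIsometry T).measurable hs,
    Measure.toSphere_apply' _ hm, Measure.toSphere_apply' _ hs]
  congr 1
  rw [← T.measurePreserving.measure_preimage_emb T.toHomeomorph.measurableEmbedding
    (Set.Ioo (0 : ℝ) 1 • (Subtype.val '' s))]
  congr 1
  ext v
  simp only [Set.mem_smul, Set.mem_image, Set.mem_preimage]
  constructor
  · rintro ⟨r, hr, _, ⟨u, hu, rfl⟩, rfl⟩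
    exact ⟨r, hr, _, ⟨_, hu, rfl⟩, (T.map_smul r _).symm⟩
  · rintro ⟨r, hr, _, ⟨u, hu, rfl⟩, h⟩
    refine ⟨r, hr, _, ⟨sphereIsometry T.symm u, ?_, rfl⟩, ?_⟩
    · convert hu
      ext1
      simp
    · apply T.injective
      rw [← h, T.map_smul, coe_sphereIsometry, T.apply_symm_apply]

/-! ### Gibbs expectations -/

section Gibbs

theorem continuous_edgeInner {V : Type*} (N : ℕ) (e : Sym2 V) :
    Continuous fun φ : V → SpinSphere N => edgeInner φ e := by
  induction e with
  | _ x y =>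
    simp only [edgeInner, Sym2.lift_mk]
    fun_prop

variable {V : Type*} [Fintype V] (G : SimpleGraph V) (N : ℕ) (β : ℝ)

theorem spinExpectation_const_mul (c : ℝ) (f : (V → SpinSphere N) → ℝ) :
    spinExpectation G N β (fun φ => c * f φ) = c * spinExpectation G N β f := by
  simp only [spinExpectation, mul_assoc]
  rw [integral_const_mul]
  ring

variable {G N} in
/-- A measure-preserving measurable equivalence of the configuration space which preserves the hamiltonian
preserves Gibbs expectations. -/
theorem spinExpectation_comp (Φ : (V → SpinSphere N) ≃ᵐ (V → SpinSphere N))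
    (hΦ : MeasurePreserving Φ (Measure.pi fun _ : V => uniformSphere N)
      (Measure.pi fun _ : V => uniformSphere N))
    (hH : ∀ φ, hamiltonian G (Φ φ) = hamiltonian G φ) (f : (V → SpinSphere N) → ℝ) :
    spinExpectation G N β (fun φ => f (Φ φ)) = spinExpectation G N β f := by
  unfold spinExpectation
  congr 1
  rw [← hΦ.integral_comp' (g := fun φ => f φ * Real.exp (-β * hamiltonian G φ))]
  simp only [hH]

theorem continuous_hamiltonian : Continuous fun φ : V → SpinSphere N => hamiltonian G φ := by
  unfold hamiltonian
  exact (continuous_finsetSum _ fun e _ => continuous_edgeInner N e).neg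

variable {G N} in
theorem hamiltonian_comp_iso (σ : G ≃g G) (φ : V → SpinSphere N) :
    hamiltonian G (fun x => φ (σ x)) = hamiltonian G φ := by
  classical
  unfold hamiltonian
  congr 1
  refine Finset.sum_nbij (Sym2.map σ) (fun e => ?_) (Sym2.map.injective σ.injective).injOn
    (fun e he => ⟨Sym2.map σ.symm e, ?_, ?_⟩) fun e _ => ?_
  all_goals
    induction e with
    | _ x y => simp_all [edgeInner, σ.map_adj_iff, σ.symm.map_adj_iff]

variable [NeZero N]

theorem integrable_spin {f : (V → SpinSphere N) → ℝ} (hf : Continuous f) :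
    Integrable f (Measure.pi fun _ : V => uniformSphere N) :=
  hf.integrable_of_hasCompactSupport (HasCompactSupport.of_compactSpace f)

theorem integrable_mul_exp_hamiltonian {f : (V → SpinSphere N) → ℝ} (hf : Continuous f) :
    Integrable (fun φ => f φ * Real.exp (-β * hamiltonian G φ))
      (Measure.pi fun _ : V => uniformSphere N) :=
  integrable_spin N <| hf.mul <|
    Real.continuous_exp.comp (continuous_const.mul (continuous_hamiltonian G N))

theorem spinPartition_pos : 0 < spinPartition G N β := by
  have h := integrable_mul_exp_hamiltonian G N β (f := fun _ => 1) continuous_const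
  simp only [one_mul] at h
  exact integral_exp_pos h

theorem spinExpectation_add {f g : (V → SpinSphere N) → ℝ} (hf : Continuous f)
    (hg : Continuous g) :
    spinExpectation G N β (fun φ => f φ + g φ) =
      spinExpectation G N β f + spinExpectation G N β g := by
  simp only [spinExpectation, add_mul]
  rw [integral_add (integrable_mul_exp_hamiltonian G N β hf)
    (integrable_mul_exp_hamiltonian G N β hg), mul_add]

theorem spinExpectation_one : spinExpectation G N β (fun _ => 1) = 1 := by
  simp only [spinExpectation, one_mul]
  exact one_div_mul_cancel (spinPartition_pos G N β).ne'

theorem spinExpectation_nonneg {f : (V → SpinSphere N) → ℝ} (hf : ∀ φ, 0 ≤ f φ) :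
    0 ≤ spinExpectation G N β f :=
  mul_nonneg (one_div_nonneg.2 (spinPartition_pos G N β).le)
    (integral_nonneg fun φ => mul_nonneg (hf φ) (Real.exp_pos _).le)

theorem spinExpectation_sum {ι : Type*} (s : Finset ι) {f : ι → (V → SpinSphere N) → ℝ}
    (hf : ∀ i, Continuous (f i)) :
    spinExpectation G N β (fun φ => ∑ i ∈ s, f i φ) = ∑ i ∈ s, spinExpectation G N β (f i) := by
  simp only [spinExpectation, Finset.sum_mul]
  rw [integral_finsetSum _ fun i _ => integrable_mul_exp_hamiltonian G N β (hf i), Finset.mul_sum]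

variable {G N}

theorem spinExpectation_comp_iso (σ : G ≃g G) (f : (V → SpinSphere N) → ℝ) :
    spinExpectation G N β (fun φ => f fun x => φ (σ x)) = spinExpectation G N β f := by
  have h := measurePreserving_piCongrLeft (fun _ : V => uniformSphere N) σ.symm.toEquiv
  have hE : ∀ φ : V → SpinSphere N,
      MeasurableEquiv.piCongrLeft (fun _ : V => SpinSphere N) σ.symm.toEquiv φ =
        fun x => φ (σ x) := fun φ => by
    ext1 x
    obtain ⟨y, rfl⟩ := σ.symm.surjective x
    exact (Equiv.piCongrLeft_apply_apply (fun _ : V => SpinSphere N) σ.symm.toEquiv φ y).trans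
      (by simp)
  have := spinExpectation_comp β _ h (G := G) (fun φ => by rw [hE, hamiltonian_comp_iso]) f
  simpa only [hE] using this

theorem spinExpectation_comp_isometry
    (T : EuclideanSpace ℝ (Fin N) ≃ₗᵢ[ℝ] EuclideanSpace ℝ (Fin N))
    (f : (V → SpinSphere N) → ℝ) :
    spinExpectation G N β (fun φ => f fun x => sphereIsometry T (φ x)) =
      spinExpectation G N β f := by
  let Φ : (V → SpinSphere N) ≃ᵐ (V → SpinSphere N) :=
    { toFun := fun φ x => sphereIsometry T (φ x)
      invFun := fun φ x => sphereIsometry T.symm (φ x)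
      left_inv := fun φ => by ext; simp
      right_inv := fun φ => by ext; simp
      measurable_toFun := (continuous_pi fun x =>
        (continuous_sphereIsometry T).comp (continuous_apply x)).measurable
      measurable_invFun := (continuous_pi fun x =>
        (continuous_sphereIsometry T.symm).comp (continuous_apply x)).measurable }
  refine spinExpectation_comp β Φ
    (measurePreserving_pi _ _ fun _ => measurePreserving_sphereIsometry T) (fun φ => ?_) f
  classical
  unfold hamiltonian
  congr 1
  refine Finset.sum_congr rfl fun e _ => ?_
  induction e with
  | _ x y => simp [edgeInner, Φ]

/-- The components of a spin have second moment `1 / N`. -/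
theorem spinExpectation_component_sq (x : V) (i : Fin N) :
    spinExpectation G N β (fun φ => (φ x : EuclideanSpace ℝ (Fin N)) i ^ 2) = 1 / N := by
  have hsymm : ∀ j : Fin N,
      spinExpectation G N β (fun φ => (φ x : EuclideanSpace ℝ (Fin N)) j ^ 2) =
        spinExpectation G N β (fun φ => (φ x : EuclideanSpace ℝ (Fin N)) i ^ 2) := fun j => by
    -- Swapping two coordinates is an isometry, so all second moments agree; they add up to
    -- `⟨‖φ_x‖²⟩ = 1`.
    rw [← spinExpectation_comp_isometry β
      (LinearIsometryEquiv.piLpCongrLeft 2 ℝ ℝ (Equiv.swap i j))]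
    simp [Equiv.piCongrLeft']
  have hsum : ∑ j : Fin N,
      spinExpectation G N β (fun φ => (φ x : EuclideanSpace ℝ (Fin N)) j ^ 2) = 1 := by
    rw [← spinExpectation_sum G N β _ fun j => by fun_prop]
    convert spinExpectation_one G N β using 2
    ext φ
    rw [← EuclideanSpace.real_norm_sq_eq]
    simp
  simp only [hsymm, Finset.sum_const, Finset.card_univ, Fintype.card_fin, nsmul_eq_mul] at hsum
  have : (N : ℝ) ≠ 0 := Nat.cast_ne_zero.2 (NeZero.ne N)
  field_simp
  linarith

end Gibbs

/-! ### Griffiths' first inequality -/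

section Griffiths

/-- The reflection which changes the sign of the coordinate `i`. -/
def coordinateFlip {N : ℕ} (i : Fin N) :
    EuclideanSpace ℝ (Fin N) ≃ₗᵢ[ℝ] EuclideanSpace ℝ (Fin N) :=
  LinearIsometryEquiv.piLpCongrRight 2 fun j =>
    if j = i then LinearIsometryEquiv.neg ℝ else LinearIsometryEquiv.refl ℝ ℝ

theorem coordinateFlip_apply {N : ℕ} (i j : Fin N) (v : EuclideanSpace ℝ (Fin N)) :
    coordinateFlip i v j = (if j = i then -1 else 1) * v j := by
  by_cases h : j = i <;> simp [coordinateFlip, h]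

/-- If all exponents are even, the integrand is nonnegative. If one is odd, flipping that coordinate
negates the integrand, so the integral vanishes. -/
theorem integral_monomial_uniformSphere_nonneg (N : ℕ) (a : Fin N → ℕ) :
    0 ≤ ∫ s : SpinSphere N, ∏ i, (s : EuclideanSpace ℝ (Fin N)) i ^ a i ∂uniformSphere N := by
  by_cases ha : ∀ i, Even (a i)
  · exact integral_nonneg fun s => Finset.prod_nonneg fun i _ => (ha i).pow_nonneg _
  · push Not at ha
    obtain ⟨i, hi⟩ := ha
    let Φ : SpinSphere N ≃ᵐ SpinSphere N :=
      { toFun := sphereIsometry (coordinateFlip i)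
        invFun := sphereIsometry (coordinateFlip i).symm
        left_inv := fun φ => by ext; simp
        right_inv := fun φ => by ext; simp
        measurable_toFun := (continuous_sphereIsometry _).measurable
        measurable_invFun := (continuous_sphereIsometry _).measurable }
    have h := MeasurePreserving.integral_comp' (f := Φ)
      (measurePreserving_sphereIsometry (coordinateFlip i))
      (fun s : SpinSphere N => ∏ i, (s : EuclideanSpace ℝ (Fin N)) i ^ a i)
    have hneg : ∀ s : SpinSphere N, ∏ j, (Φ s : EuclideanSpace ℝ (Fin N)) j ^ a j =
        -∏ j, (s : EuclideanSpace ℝ (Fin N)) j ^ a j := fun s => by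
      have : ∀ j, (Φ s : EuclideanSpace ℝ (Fin N)) j ^ a j =
          (if j = i then -1 else 1) * (s : EuclideanSpace ℝ (Fin N)) j ^ a j := fun j => by
        change (coordinateFlip i s) j ^ a j = _
        rw [coordinateFlip_apply, mul_pow]
        by_cases hj : j = i
        · subst hj
          simp [(Nat.not_even_iff_odd.1 hi).neg_one_pow]
        · simp [hj]
      simp only [this, Finset.prod_mul_distrib]
      simp
    simp only [hneg, integral_neg] at h
    linarith

variable (V : Type*) (N : ℕ)

/-- The component `i` of the spin at `x`, as a continuous function of the configuration. -/
def spinComponent {V : Type*} {N : ℕ} (x : V) (i : Fin N) : C(V → SpinSphere N, ℝ) :=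
  ⟨fun φ => (φ x : EuclideanSpace ℝ (Fin N)) i, by fun_prop⟩

/-- The closed cone of functions generated by the monomials in the spin components. -/
def ferromagneticCone : Subalgebra NNReal C(V → SpinSphere N, ℝ) :=
  (Algebra.adjoin NNReal
    (Set.range fun p : V × Fin N => spinComponent p.1 p.2)).topologicalClosure

variable {V N}

theorem spinComponent_mem (x : V) (i : Fin N) : spinComponent x i ∈ ferromagneticCone V N :=
  Subalgebra.le_topologicalClosure _ (Algebra.subset_adjoin ⟨(x, i), rfl⟩)

variable [Fintype V]

/-- The exponential series has nonnegative coefficients and the cone is closed under limits. -/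
theorem exp_mem_ferromagneticCone {f : C(V → SpinSphere N, ℝ)}
    (hf : f ∈ ferromagneticCone V N) : NormedSpace.exp f ∈ ferromagneticCone V N := by
  have h := NormedSpace.exp_series_hasSum_exp' (𝕂 := ℝ) f
  refine (Subalgebra.isClosed_topologicalClosure _).mem_of_tendsto h
    (Filter.Eventually.of_forall fun s => sum_mem fun n _ => ?_)
  have := (ferromagneticCone V N).smul_mem (pow_mem hf n) (n.factorial : NNReal)⁻¹
  have hsmul : (n.factorial : NNReal)⁻¹ • f ^ n = (n.factorial : ℝ)⁻¹ • f ^ n := by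
    ext φ
    simp [NNReal.smul_def]
  rwa [hsmul] at this

theorem exp_continuousMap_apply {X : Type*} [TopologicalSpace X] [CompactSpace X] (f : C(X, ℝ))
    (x : X) : NormedSpace.exp f x = Real.exp (f x) := by
  rw [Real.exp_eq_exp_ℝ]
  exact NormedSpace.map_exp (ContinuousMap.evalAlgHom ℝ ℝ x) (continuous_eval_const x) f

theorem exists_monomial_of_mem_closure {f : C(V → SpinSphere N, ℝ)}
    (hf : f ∈ Submonoid.closure (Set.range fun p : V × Fin N => spinComponent p.1 p.2)) :
    ∃ a : V → Fin N → ℕ,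
      ∀ φ, f φ = ∏ x, ∏ i, (φ x : EuclideanSpace ℝ (Fin N)) i ^ a x i := by
  classical
  induction hf using Submonoid.closure_induction with
  | mem f hf =>
    obtain ⟨⟨x, i⟩, rfl⟩ := hf
    refine ⟨fun y j => if y = x then if j = i then 1 else 0 else 0, fun φ => ?_⟩
    rw [Finset.prod_eq_single x (fun y _ hy => by simp [hy]) (by simp),
      Finset.prod_eq_single i (fun y _ hy => by simp [hy]) (by simp)]
    simp [spinComponent]
  | one => exact ⟨0, by simp⟩
  | mul f g _ _ hf hg =>
    obtain ⟨a, ha⟩ := hf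
    obtain ⟨b, hb⟩ := hg
    exact ⟨a + b, fun φ => by simp [ha, hb, pow_add, Finset.prod_mul_distrib]⟩

/-- The integral is continuous in the sup norm, so nonnegative combinations of monomials suffice;
the integral of a monomial factorises over the vertices. -/
theorem integral_nonneg_of_mem_ferromagneticCone [NeZero N] {f : C(V → SpinSphere N, ℝ)}
    (hf : f ∈ ferromagneticCone V N) :
    0 ≤ ∫ φ, f φ ∂(Measure.pi fun _ : V => uniformSphere N) := by
  have hcont : Continuous fun f : C(V → SpinSphere N, ℝ) =>
      ∫ φ, f φ ∂(Measure.pi fun _ : V => uniformSphere N) := by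
    refine (LipschitzWith.of_dist_le_mul (K := 1) fun f g => ?_).continuous
    rw [dist_eq_norm, dist_eq_norm, ← integral_sub (integrable_spin N f.continuous)
      (integrable_spin N g.continuous)]
    refine (norm_integral_le_of_norm_le_const (C := ‖f - g‖)
      (Filter.Eventually.of_forall fun φ => (f - g).norm_coe_le_norm φ)).trans ?_
    simp
  have hclosed := isClosed_Ici (a := (0 : ℝ)).preimage hcont
  refine closure_minimal (fun f hf => ?_) hclosed hf
  replace hf : f ∈ Subalgebra.toSubmodule (Algebra.adjoin NNReal
    (Set.range fun p : V × Fin N => spinComponent p.1 p.2)) := hf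
  rw [Algebra.adjoin_eq_span] at hf
  change 0 ≤ ∫ φ, f φ ∂(Measure.pi fun _ : V => uniformSphere N)
  induction hf using Submodule.span_induction with
  | mem f hf =>
    obtain ⟨a, ha⟩ := exists_monomial_of_mem_closure hf
    simp only [ha]
    rw [integral_fintype_prod_eq_prod
      (f := fun x (s : SpinSphere N) => ∏ i, (s : EuclideanSpace ℝ (Fin N)) i ^ a x i)]
    exact Finset.prod_nonneg fun x _ => integral_monomial_uniformSphere_nonneg N (a x)
  | zero => simp
  | add f g _ _ hf hg =>
    simp only [ContinuousMap.add_apply]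
    rw [integral_add (integrable_spin N f.continuous) (integrable_spin N g.continuous)]
    exact add_nonneg hf hg
  | smul c f _ hf =>
    simp only [ContinuousMap.smul_apply, NNReal.smul_def, smul_eq_mul]
    rw [integral_const_mul]
    exact mul_nonneg c.2 hf

/-- Griffiths' first inequality for functions in the ferromagnetic cone. -/
theorem spinExpectation_nonneg_of_mem_ferromagneticCone [NeZero N] (G : SimpleGraph V) {β : ℝ}
    (hβ : 0 ≤ β) {f : C(V → SpinSphere N, ℝ)} (hf : f ∈ ferromagneticCone V N) :
    0 ≤ spinExpectation G N β f := by
  classical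
  lift β to NNReal using hβ
  refine mul_nonneg (one_div_nonneg.2 (spinPartition_pos G N β).le) ?_
  have hedge : ∀ e : Sym2 V,
      (⟨fun φ => edgeInner φ e, continuous_edgeInner N e⟩ : C(V → SpinSphere N, ℝ)) ∈
        ferromagneticCone V N := fun e => by
    induction e with
    | _ x y =>
      have := sum_mem (S := ferromagneticCone V N) (t := Finset.univ) fun i _ =>
        mul_mem (spinComponent_mem (V := V) (N := N) x i) (spinComponent_mem y i)
      convert this using 1
      ext φ
      simp [edgeInner, spinComponent, PiLp.inner_apply, mul_comm]
  have hH := (ferromagneticCone V N).smul_mem (sum_mem (t := G.edgeFinset)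
    fun e _ => hedge e) β
  -- The Gibbs weight `exp (-β H)` is the exponential of `β` times the sum of the edge inner
  -- products, hence lies in the cone.
  have h := integral_nonneg_of_mem_ferromagneticCone (mul_mem hf (exp_mem_ferromagneticCone hH))
  refine h.trans_eq (integral_congr_ae (Filter.Eventually.of_forall fun φ => ?_))
  simp [exp_continuousMap_apply, NNReal.smul_def, hamiltonian]

end Griffiths

/-! ### The torus -/

section Torus

variable {d L : ℕ}

/-- Translations are automorphisms of the torus. -/
def torusTranslation (d L : ℕ) (v : Torus d L) : torusGraph d L ≃g torusGraph d L where
  toEquiv := Equiv.addRight v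
  map_rel_iff' {x y} := by
    simp [torusGraph, SimpleGraph.fromRel_adj, add_right_comm _ v]

variable [NeZero L] {N : ℕ} [NeZero N] (β : ℝ)

theorem spinExpectation_component_mul (x y : Torus d L) :
    spinExpectation (torusGraph d L) N β (fun φ =>
      (φ x : EuclideanSpace ℝ (Fin N)) 0 * (φ y : EuclideanSpace ℝ (Fin N)) 0) =
        twoPoint d L N β (y - x) := by
  have h : ∀ z, torusTranslation d L x z = z + x := fun _ => rfl
  have := spinExpectation_comp_iso (N := N) β (torusTranslation d L x) fun φ =>
    (φ 0 : EuclideanSpace ℝ (Fin N)) 0 * (φ (y - x) : EuclideanSpace ℝ (Fin N)) 0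
  simpa [h, twoPoint] using this

theorem twoPoint_nonneg (hβ : 0 ≤ β) (y : Torus d L) : 0 ≤ twoPoint d L N β y :=
  spinExpectation_nonneg_of_mem_ferromagneticCone _ hβ
    (mul_mem (spinComponent_mem 0 0) (spinComponent_mem y 0))

theorem spinExpectation_component_sub_sq (x y : Torus d L) :
    spinExpectation (torusGraph d L) N β (fun φ =>
      ((φ x : EuclideanSpace ℝ (Fin N)) 0 - (φ y : EuclideanSpace ℝ (Fin N)) 0) ^ 2) =
        2 * (1 / N - twoPoint d L N β (y - x)) := by
  have h : ∀ φ : Torus d L → SpinSphere N,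
      ((φ x : EuclideanSpace ℝ (Fin N)) 0 - (φ y : EuclideanSpace ℝ (Fin N)) 0) ^ 2 =
        ((φ x : EuclideanSpace ℝ (Fin N)) 0 ^ 2 + (φ y : EuclideanSpace ℝ (Fin N)) 0 ^ 2) +
        (-2) * ((φ x : EuclideanSpace ℝ (Fin N)) 0 * (φ y : EuclideanSpace ℝ (Fin N)) 0) :=
    fun φ => by ring
  simp only [h]
  rw [spinExpectation_add _ _ _ (by fun_prop) (by fun_prop),
    spinExpectation_add _ _ _ (by fun_prop) (by fun_prop), spinExpectation_const_mul,
    spinExpectation_component_sq, spinExpectation_component_sq, spinExpectation_component_mul]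
  ring

/-- The defect `1/N - ⟨φ¹_o φ¹_y⟩` is half a squared `L²` distance, hence obeys a quadratic
triangle inequality. -/
theorem twoPoint_defect_le (y z : Torus d L) :
    1 / (N : ℝ) - twoPoint d L N β y ≤
      2 * (1 / N - twoPoint d L N β z) + 2 * (1 / N - twoPoint d L N β (y - z)) := by
  have h := spinExpectation_nonneg (torusGraph d L) N β (f := fun φ =>
    (2 * ((φ 0 : EuclideanSpace ℝ (Fin N)) 0 - (φ z : EuclideanSpace ℝ (Fin N)) 0) ^ 2 +
      2 * ((φ z : EuclideanSpace ℝ (Fin N)) 0 - (φ y : EuclideanSpace ℝ (Fin N)) 0) ^ 2) +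
    (-1) * ((φ 0 : EuclideanSpace ℝ (Fin N)) 0 - (φ y : EuclideanSpace ℝ (Fin N)) 0) ^ 2)
    fun φ => by
      -- This is `2a² + 2b² - (a + b)² = (a - b)²` with `a = φ¹_o - φ¹_z` and `b = φ¹_z - φ¹_y`.
      nlinarith [sq_nonneg ((φ 0 : EuclideanSpace ℝ (Fin N)) 0 -
        2 * (φ z : EuclideanSpace ℝ (Fin N)) 0 + (φ y : EuclideanSpace ℝ (Fin N)) 0)]
  rw [spinExpectation_add _ _ _ (by fun_prop) (by fun_prop),
    spinExpectation_add _ _ _ (by fun_prop) (by fun_prop), spinExpectation_const_mul,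
    spinExpectation_const_mul, spinExpectation_const_mul, spinExpectation_component_sub_sq,
    spinExpectation_component_sub_sq, spinExpectation_component_sub_sq, sub_zero, sub_zero] at h
  linarith

/-- A lower bound for the average of the two-point function gives a pointwise lower bound. -/
theorem twoPoint_ge_of_average {δ : ℝ}
    (havg : (1 / (Fintype.card (Torus d L) : ℝ)) * ∑ z : Torus d L, twoPoint d L N β z
      ≥ 1 / (N : ℝ) - δ) (y : Torus d L) :
    1 / (N : ℝ) - 4 * δ ≤ twoPoint d L N β y := by
  have hcard : (0 : ℝ) < Fintype.card (Torus d L) := Nat.cast_pos.2 Fintype.card_pos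
  have hsum := Finset.sum_le_sum fun z (_ : z ∈ Finset.univ) =>
    twoPoint_defect_le (N := N) β y z
  -- Since `z ↦ y - z` permutes the torus, both terms have the same average, whence the constant `4
  -- = 2 + 2`.
  have hshift : ∑ z, twoPoint d L N β (y - z) = ∑ z, twoPoint d L N β z :=
    Equiv.sum_comp (Equiv.subLeft y) _
  simp only [Finset.sum_add_distrib, ← Finset.mul_sum, Finset.sum_sub_distrib, hshift,
    Finset.sum_const, Finset.card_univ, nsmul_eq_mul] at hsum
  rw [ge_iff_le, one_div_mul_eq_div, le_div_iff₀ hcard] at havg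
  refine le_of_mul_le_mul_left (a := (Fintype.card (Torus d L) : ℝ)) ?_ hcard
  linarith

end Torus

/-! ### Conclusion -/

/-- Follows from `β ≤ 2dβ + 1 ≤ exp (2dβ)` and `N ≥ 1`. -/
theorem mul_exp_neg_div_le_one {d N : ℕ} [NeZero N] (hd : 1 ≤ d) {β : ℝ} (hβ : 0 ≤ β) :
    β * Real.exp (-(2 * (d : ℝ) * β)) / (N : ℝ) ≤ 1 := by
  have hd' : (1 : ℝ) ≤ d := by exact_mod_cast hd
  have hN : (1 : ℝ) ≤ N := by exact_mod_cast NeZero.one_le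
  refine div_le_one_of_le₀ (le_trans ?_ hN) (by positivity)
  rw [Real.exp_neg, ← div_eq_mul_inv]
  refine div_le_one_of_le₀ ?_ (Real.exp_pos _).le
  nlinarith [Real.add_one_le_exp (2 * (d : ℝ) * β)]

end

theorem lemma4p1 (d L N : ℕ) [NeZero L] [NeZero N] (hd : 2 ≤ d) (hL : Even L)
    (β : ℝ) (hβ : 0 ≤ β) (δ : ℝ) (hδ0 : 0 < δ) (hδ1 : δ < 1)
    (havg : (1 / (Fintype.card (Torus d L) : ℝ)) * ∑ z : Torus d L, twoPoint d L N β z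
      ≥ 1 / (N : ℝ) - δ) :
    (∀ y ∈ torusBox d L ((L : ℝ) / 8) ∩ axesOrGeneric d L,
      twoPoint d L N β y ≥ 1 / (N : ℝ) - 2 ^ (2 * d) * δ) ∧
    (∀ y ∈ torusBox d L ((L : ℝ) / 8) \ axesOrGeneric d L,
      twoPoint d L N β y ≥ (1 / (N : ℝ) - 2 ^ (2 * d) * δ) *
        (β * Real.exp (-(2 * (d : ℝ) * β)) / (N : ℝ)) ^ (d - 2)) := by
  have hpow : (4 : ℝ) ≤ 2 ^ (2 * d) :=
    calc (4 : ℝ) = 2 ^ 2 := by norm_num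
      _ ≤ 2 ^ (2 * d) := pow_le_pow_right₀ one_le_two (by omega)
  have key : ∀ y, 1 / (N : ℝ) - 2 ^ (2 * d) * δ ≤ twoPoint d L N β y := fun y =>
    le_trans (sub_le_sub_left (mul_le_mul_of_nonneg_right hpow hδ0.le) _)
      (twoPoint_ge_of_average β havg y)
  refine ⟨fun y _ => key y, fun y _ => ?_⟩
  have hc0 : 0 ≤ β * Real.exp (-(2 * (d : ℝ) * β)) / (N : ℝ) := by positivity
  have hc1 := mul_exp_neg_div_le_one (N := N) (by omega : 1 ≤ d) hβ
  -- Multiplying by a power of a number in `[0, 1]` lowers a nonnegative bound but raises a negative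
  -- one, so the second case rests on nonnegativity of the two-point function.
  rcases le_total 0 (1 / (N : ℝ) - 2 ^ (2 * d) * δ) with h | h
  · exact (mul_le_of_le_one_right h (pow_le_one₀ hc0 hc1)).trans (key y)
  · exact (mul_nonpos_of_nonpos_of_nonneg h (pow_nonneg hc0 _)).trans (twoPoint_nonneg β hβ y)
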